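/- **Theorem 1.1.** Call a set of three distinct points of the Euclidean plane $\mathbb{R}^2$ (possibly collinear) a *triangle*, and call two triangles congruent if some isometry of the plane (orientation-reversing ones included) maps one set onto the other. The *distinct triangles spanned by* $S\subseteq\mathbb{R}^2$ are the congruence classes of the triangles with all three vertices in $S$. Then every set $S\subseteq\mathbb{R}^2$ that spans at most $3$ distinct triangles has at most $6$ points. Moreover, a set $S\subseteq\mathbb{R}^2$ has exactly $6$ points and spans at most $3$ distinct triangles if and only if $S$ is the vertex set of a (non-degenerate) regular hexagon. -/

import Mathlib

/-- The Euclidean plane. -/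
abbrev Plane : Type := EuclideanSpace ℝ (Fin 2)

/-- A triangle is an unordered triple of distinct points of the plane; the three points may be
collinear. -/
abbrev Triangle : Type := {T : Set Plane // T.encard = 3}

/-- Congruence of triangles: a rigid isometry of the plane (possibly orientation-reversing) carries
the one vertex set onto the other. -/
def triangleSetoid : Setoid Triangle where
  r T U := ∃ e : Plane ≃ᵢ Plane, e '' T.1 = U.1
  iseqv :=
    { refl := fun T => ⟨IsometryEquiv.refl Plane, Set.image_id T.1⟩
      symm := by
        rintro T U ⟨e, he⟩
        refine ⟨e.symm, ?_⟩
        rw [← he, Set.image_image]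
        simp
      trans := by
        rintro T U V ⟨e, he⟩ ⟨f, hf⟩
        refine ⟨e.trans f, ?_⟩
        rw [← hf, ← he, Set.image_image]
        rfl }

/-- The distinct triangles spanned by a point set `S`: the congruence classes of the triangles
whose three vertices belong to `S`. -/
def distinctTriangles (S : Set Plane) : Set (Quotient triangleSetoid) :=
  Quotient.mk triangleSetoid '' {T : Triangle | T.1 ⊆ S}

/-- `S` is the vertex set of a regular hexagon with centre `c`, circumradius `r > 0` and a vertex
in the direction of angle `θ`. -/
def IsRegularHexagon (S : Set Plane) : Prop :=
  ∃ (c : Plane) (r θ : ℝ), 0 < r ∧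
    S = Set.range fun k : Fin 6 =>
      c + r • !₂[Real.cos (θ + ((k : ℕ) : ℝ) * (Real.pi / 3)),
        Real.sin (θ + ((k : ℕ) : ℝ) * (Real.pi / 3))]

/-- The (scaled) Gram determinant of four points in terms of their squared mutual distances
`a = |01|²`, `b = |02|²`, `c = |12|²`, `d = |03|²`, `e = |13|²`, `f = |23|²`. -/
def gramDet (a b c d e f : ℝ) : ℝ :=
  2 * a * (4 * b * d - (b + d - f) ^ 2) - (a + b - c) * (2 * d * (a + b - c) - (a + d - e) * (b + d - f))
    + (a + d - e) * ((a + b - c) * (b + d - f) - 2 * b * (a + d - e))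

theorem plane_dist_sq (x y : Plane) : dist x y ^ 2 = (x 0 - y 0) ^ 2 + (x 1 - y 1) ^ 2 := by
  rw [EuclideanSpace.dist_eq, Real.sq_sqrt (by positivity)]
  simp [Fin.sum_univ_two, Real.dist_eq, sq_abs]

theorem gramDet_eq_zero (p q r s : Plane) :
    gramDet (dist p q ^ 2) (dist p r ^ 2) (dist q r ^ 2) (dist p s ^ 2) (dist q s ^ 2)
      (dist r s ^ 2) = 0 := by
  simp only [plane_dist_sq, gramDet]
  ring

/-- The number of monochromatic triangles of a 2-colouring of `K₄`. -/
def monoTriangles (u : Fin 6 → Bool) : ℕ :=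
  (if u 0 = u 1 ∧ u 0 = u 2 then 1 else 0) + (if u 0 = u 3 ∧ u 0 = u 4 then 1 else 0) +
    (if u 1 = u 3 ∧ u 1 = u 5 then 1 else 0) + (if u 2 = u 4 ∧ u 2 = u 5 then 1 else 0)

/-- If four points of the plane span exactly two distances, with squares `A` and `B`, then
`6 * (A ^ 2 + B ^ 2) = m * (A * B)` where `m` depends only on the pattern of distances. -/
def ratioCoeff (u : Fin 6 → Bool) : ℕ :=
  if xor (u 0) (xor (u 1) (xor (u 2) (xor (u 3) (xor (u 4) (u 5))))) then
    if monoTriangles u = 0 then 18 else 20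
  else if monoTriangles u = 0 then 15 else 24

theorem ratio_of_gramDet (A B : ℝ) (hA : 0 < A) (hB : 0 < B) (u : Fin 6 → Bool)
    (hu : ∃ i j, u i ≠ u j)
    (h : gramDet (cond (u 0) A B) (cond (u 1) A B) (cond (u 2) A B) (cond (u 3) A B)
      (cond (u 4) A B) (cond (u 5) A B) = 0) :
    6 * (A ^ 2 + B ^ 2) = ratioCoeff u * (A * B) := by
  have hAB : A + B ≠ 0 := by positivity
  have hA' := hA.ne'
  have hB' := hB.ne'
  have hu' : ¬ (u 0 = u 1 ∧ u 0 = u 2 ∧ u 0 = u 3 ∧ u 0 = u 4 ∧ u 0 = u 5) := by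
    rintro ⟨h1, h2, h3, h4, h5⟩
    obtain ⟨i, j, hij⟩ := hu
    apply hij
    fin_cases i <;> fin_cases j <;> simp_all
  clear hu
  unfold gramDet at h
  unfold ratioCoeff monoTriangles
  revert h hu'
  generalize u 0 = u0
  generalize u 1 = u1
  generalize u 2 = u2
  generalize u 3 = u3
  generalize u 4 = u4
  generalize u 5 = u5
  intro hu h
  cases u0 <;> cases u1 <;> cases u2 <;> cases u3 <;> cases u4 <;> cases u5 <;> 
    simp at hu h ⊢ <;> grind

/-- The pairs `(i, j)` with `i < j < n`. -/
def pairs (n : ℕ) : List (ℕ × ℕ) :=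
  (List.range n).flatMap fun j => (List.range j).map fun i => (i, j)

/-- The triples `(a, b, c)` with `a < b < c < n`. -/
def triples (n : ℕ) : List (ℕ × ℕ × ℕ) :=
  (List.range n).flatMap fun c => (pairs c).map fun p => (p.1, p.2, c)

/-- The quadruples `(a, b, c, d)` with `a < b < c < d < n`. -/
def quads (n : ℕ) : List (ℕ × ℕ × ℕ × ℕ) :=
  (List.range n).flatMap fun d => (triples d).map fun t => (t.1, t.2.1, t.2.2, d)

/-- No three points have the same distance from each of two points. -/
def noCommonCircles (c : ℕ → ℕ → ℕ) (n : ℕ) : Bool :=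
  (pairs n).all fun p => (triples n).all fun t =>
    !(Nat.beq (c p.1 t.1) (c p.1 t.2.1) && Nat.beq (c p.1 t.2.1) (c p.1 t.2.2) &&
      Nat.beq (c p.2 t.1) (c p.2 t.2.1) && Nat.beq (c p.2 t.2.1) (c p.2 t.2.2))

/-- The colours of the six edges of a quadruple. -/
def quadColors (c : ℕ → ℕ → ℕ) (q : ℕ × ℕ × ℕ × ℕ) : List ℕ :=
  [c q.1 q.2.1, c q.1 q.2.2.1, c q.2.1 q.2.2.1, c q.1 q.2.2.2, c q.2.1 q.2.2.2,
    c q.2.2.1 q.2.2.2]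

/-- The two colours of a two-coloured quadruple, with the ratio coefficient of its pattern. The
second colour is zero if there is only one. -/
def ratioCode (l : List ℕ) : Option (ℕ × ℕ × ℕ) :=
  let a := l.getD 0 0
  let b := (l.find? fun x => !Nat.beq x a).getD 0
  bif l.all fun x => Nat.beq x a || Nat.beq x b then
    some (a, b, ratioCoeff fun i => Nat.beq (l.getD i 0) a)
  else none

/-- The ratio codes do not contradict each other, and no quadruple has only one colour. -/
def ratiosConsistent (c : ℕ → ℕ → ℕ) (n : ℕ) : Bool :=
  let L := (quads n).filterMap fun q => ratioCode (quadColors c q)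
  L.all fun x => !Nat.beq x.2.1 0 && L.all fun y =>
    !((Nat.beq x.1 y.1 && Nat.beq x.2.1 y.2.1) || (Nat.beq x.1 y.2.1 && Nat.beq x.2.1 y.1)) ||
      Nat.beq x.2.2 y.2.2

/-- Insert an element unless it is there. -/
def insertNew (x : ℕ) (l : List ℕ) : List ℕ := bif l.any (Nat.beq x) then l else x :: l

/-- A partial colouring of the edges of a complete graph: the edges `(i, j)` with `i < j` are
coloured in lexicographic order of `(j, i)`. -/
structure PartialColoring where
  /-- The colours of the edges `(0, j)`, ..., `(j - 1, j)` for the vertices `j` that are done. -/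
  rows : List (List ℕ)
  /-- The colours of the edges `(0, j)`, ..., `(i - 1, j)` for the vertex `j` in progress. -/
  row : List ℕ
  /-- The colours of the triangles, each coded by the sum of the colours of its sides. -/
  types : List ℕ
  /-- The colours used so far. -/
  colors : List ℕ

/-- The extensions of partial colourings by a colour of the edge `(i, j)` such that there are at
most three types of triangles, and all new triangles are of a certain form. -/
def addEdge (allowed : ℕ → ℕ → ℕ → Bool) (j : ℕ) (L : List PartialColoring) (i : ℕ) :
    List PartialColoring :=
  L.flatMap fun s =>
    let prev := s.rows.getD i []
    (4 ^ (j * (j - 1) / 2 + i) :: s.colors).filterMap fun x =>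
      let T := (List.zipWith (fun a b => Nat.add (Nat.add a b) x) prev s.row).foldr
        insertNew s.types
      bif Nat.ble T.length 3 && (List.zipWith (fun a b => allowed a b x) prev s.row).all id
      then some ⟨s.rows, s.row ++ [x], T, insertNew x s.colors⟩ else none

/-- The colour of the pair `(i, j)`. -/
def color (rows : List (List ℕ)) (i j : ℕ) : ℕ :=
  bif Nat.beq i j then 0
  else bif Nat.ble i j then (rows.getD j []).getD i 0 else (rows.getD i []).getD j 0

/-- The extensions of colourings of the complete graph on `j` vertices by one vertex. -/
def addVertex (allowed : ℕ → ℕ → ℕ → Bool) (L : List PartialColoring) (j : ℕ) :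
    List PartialColoring :=
  (((List.range j).foldl (addEdge allowed j) L).map fun s =>
    ⟨s.rows ++ [s.row], [], s.types, s.colors⟩).filter fun s =>
      ratiosConsistent (color s.rows) (j + 1) && noCommonCircles (color s.rows) (j + 1)

/-- The colourings of the complete graph on six vertices such that the triangle `(0, 1, 2)` is of
the form `first` and all other triangles are of the form `other`. -/
def colorings (first other : ℕ → ℕ → ℕ → Bool) : List PartialColoring :=
  [3, 4, 5].foldl (addVertex other) ([0, 1, 2].foldl (addVertex first) [⟨[], [], [], []⟩])

/-- A triangle with sides of one colour. -/
def isMono (a b c : ℕ) : Bool := Nat.beq a b && Nat.beq b c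

/-- A triangle whose first two sides are of one colour, and the third is not. -/
def isIsosceles (a b c : ℕ) : Bool := Nat.beq a b && !Nat.beq b c

/-- A triangle with sides of three colours. -/
def isScalene (a b c : ℕ) : Bool := !(Nat.beq a b || Nat.beq b c || Nat.beq a c)

/-- The colours of a regular hexagon in which the points `x`, `y`, `z` are opposite to `0`, `1`,
`2`. -/
def isHexagonColoring (c : ℕ → ℕ → ℕ) (x y z : ℕ) : Bool :=
  [c 0 2, c 1 2, c x y, c x z, c y z].all (Nat.beq (c 0 1)) &&
  [c 0 z, c 1 x, c 1 z, c 2 x, c 2 y].all (Nat.beq (c 0 y)) &&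
  [c 1 y, c 2 z].all (Nat.beq (c 0 x))

theorem colorings_mono :
    ((colorings isMono fun _ _ _ => true).all fun s =>
      [(3, 4, 5), (3, 5, 4), (4, 3, 5), (4, 5, 3), (5, 3, 4), (5, 4, 3)].any fun t =>
        isHexagonColoring (color s.rows) t.1 t.2.1 t.2.2) = true := by
  decide +kernel

theorem colorings_isosceles :
    (colorings isIsosceles fun a b c => !isMono a b c).isEmpty = true := by
  decide +kernel

theorem colorings_scalene : (colorings isScalene isScalene).isEmpty = true := by
  decide +kernel

/-- The position of the edge `(i, j)`, where `i < j`, in the order in which edges are coloured. -/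
def edge (i j : ℕ) : ℕ := j * (j - 1) / 2 + i

theorem edge_inj {a b i j : ℕ} (hab : a < b) (hb : b < 6) (hij : i < j) (hj : j < 6)
    (h : edge a b = edge i j) : a = i ∧ b = j := by
  unfold edge at h
  interval_cases b <;> interval_cases j <;> simp at h <;> omega

theorem mem_pairs {n : ℕ} {p : ℕ × ℕ} : p ∈ pairs n ↔ p.1 < p.2 ∧ p.2 < n := by
  obtain ⟨a, b⟩ := p
  simp only [pairs, List.mem_flatMap, List.mem_range, List.mem_map, Prod.mk.injEq]
  constructor
  · rintro ⟨j, hj, i, hi, rfl, rfl⟩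
    exact ⟨hi, hj⟩
  · rintro ⟨h1, h2⟩
    exact ⟨b, h2, a, h1, rfl, rfl⟩

theorem mem_triples {n : ℕ} {t : ℕ × ℕ × ℕ} :
    t ∈ triples n ↔ t.1 < t.2.1 ∧ t.2.1 < t.2.2 ∧ t.2.2 < n := by
  obtain ⟨a, b, c⟩ := t
  simp only [triples, List.mem_flatMap, List.mem_range, List.mem_map, Prod.mk.injEq, mem_pairs]
  constructor
  · rintro ⟨j, hj, ⟨p, q⟩, ⟨h1, h2⟩, rfl, rfl, rfl⟩
    exact ⟨h1, h2, hj⟩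
  · rintro ⟨h1, h2, h3⟩
    exact ⟨c, h3, (a, b), ⟨h1, h2⟩, rfl, rfl, rfl⟩

theorem mem_quads {n : ℕ} {q : ℕ × ℕ × ℕ × ℕ} :
    q ∈ quads n ↔ q.1 < q.2.1 ∧ q.2.1 < q.2.2.1 ∧ q.2.2.1 < q.2.2.2 ∧ q.2.2.2 < n := by
  obtain ⟨a, b, c, d⟩ := q
  simp only [quads, List.mem_flatMap, List.mem_range, List.mem_map, Prod.mk.injEq, mem_triples]
  constructor
  · rintro ⟨j, hj, ⟨p, q, r⟩, ⟨h1, h2, h3⟩, rfl, rfl, rfl, rfl⟩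
    exact ⟨h1, h2, h3, hj⟩
  · rintro ⟨h1, h2, h3, h4⟩
    exact ⟨d, h4, (a, b, c), ⟨h1, h2, h3⟩, rfl, rfl, rfl, rfl⟩

theorem mem_insertNew {x y : ℕ} {l : List ℕ} : y ∈ insertNew x l ↔ y = x ∨ y ∈ l := by
  unfold insertNew
  cases h : l.any (Nat.beq x)
  · simp
  · obtain ⟨z, hz, h⟩ := List.any_eq_true.1 h
    obtain rfl := Nat.eq_of_beq_eq_true h
    simp only [cond_true]
    exact ⟨Or.inr, by rintro (rfl | h) <;> assumption⟩

theorem nodup_insertNew {x : ℕ} {l : List ℕ} (h : l.Nodup) : (insertNew x l).Nodup := by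
  unfold insertNew
  cases h' : l.any (Nat.beq x)
  · simp only [cond_false, List.nodup_cons, h, and_true]
    intro hx
    have : l.any (Nat.beq x) = true := List.any_eq_true.2 ⟨x, hx, Nat.beq_refl x⟩
    simp_all
  · exact h

theorem nodup_foldr_insertNew (t l : List ℕ) (h : l.Nodup) : (t.foldr insertNew l).Nodup := by
  induction t with
  | nil => exact h
  | cons a t ih => exact nodup_insertNew ih

theorem mem_foldr_insertNew {t l : List ℕ} {x : ℕ} :
    x ∈ t.foldr insertNew l ↔ x ∈ t ∨ x ∈ l := by
  induction t with
  | nil => simp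
  | cons a t ih => simp [mem_insertNew, ih, or_assoc]

/-- A colouring of the edges of the complete graph on six vertices that has the combinatorial
properties of the colouring by distances of six points of the plane spanning at most three
triangles. -/
structure Admissible (c : ℕ → ℕ → ℕ) : Prop where
  symm : ∀ i j, c i j = c j i
  diag : ∀ i, c i i = 0
  labels : ∀ j < 6, ∀ i < j, c i j = 4 ^ edge i j ∨
    ∃ b < 6, ∃ a < b, edge a b < edge i j ∧ c a b = c i j
  types : ∃ T : Finset ℕ, T.card ≤ 3 ∧
    ∀ k < 6, ∀ j < k, ∀ i < j, c i j + c i k + c j k ∈ T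
  circles : ∀ n ≤ 6, ∀ c', (∀ i < n, ∀ j < n, c' i j = c i j) → noCommonCircles c' n = true
  ratios : ∀ n ≤ 6, ∀ c', (∀ i < n, ∀ j < n, c' i j = c i j) → ratiosConsistent c' n = true

/-- The first `i` entries of the row of the vertex `j`. -/
def rowOf (c : ℕ → ℕ → ℕ) (j i : ℕ) : List ℕ := (List.range i).map fun a => c a j

/-- The complete rows of the first `j` vertices. -/
def rowsOf (c : ℕ → ℕ → ℕ) (j : ℕ) : List (List ℕ) := (List.range j).map fun b => rowOf c b b

theorem color_rowsOf {c : ℕ → ℕ → ℕ} (hc : Admissible c) {n i j : ℕ} (hi : i < n) (hj : j < n) :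
    color (rowsOf c n) i j = c i j := by
  unfold color
  rcases lt_trichotomy i j with h | rfl | h
  · have h1 : Nat.beq i j = false := by
      rw [Bool.eq_false_iff]; exact fun h' => h.ne (Nat.eq_of_beq_eq_true h')
    have h2 : Nat.ble i j = true := by simp [h.le]
    simp [h1, h2, rowsOf, rowOf, hj, h]
  · simp [hc.diag]
  · have h1 : Nat.beq i j = false := by
      rw [Bool.eq_false_iff]; exact fun h' => h.ne' (Nat.eq_of_beq_eq_true h')
    have h2 : Nat.ble i j = false := by
      rw [Bool.eq_false_iff]; simp [h]
    simp [h1, h2, rowsOf, rowOf, hi, h, hc.symm i j]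

/-- The restriction of `c` to the edges before `(i, j)` is in the list `L`. -/
def Extends (c : ℕ → ℕ → ℕ) (T : Finset ℕ) (j i : ℕ) (L : List PartialColoring) : Prop :=
  ∃ s ∈ L, s.rows = rowsOf c j ∧ s.row = rowOf c j i ∧ s.types.Nodup ∧ (∀ x ∈ s.types, x ∈ T) ∧
    ∀ b < 6, ∀ a < b, edge a b < edge i j → c a b ∈ s.colors

theorem Extends.addEdge {c : ℕ → ℕ → ℕ} (hc : Admissible c) {T : Finset ℕ} (hT : T.card ≤ 3)
    (hT' : ∀ k < 6, ∀ j < k, ∀ i < j, c i j + c i k + c j k ∈ T)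
    {allowed : ℕ → ℕ → ℕ → Bool} {i j : ℕ} {L : List PartialColoring} (hij : i < j) (hj : j < 6)
    (hall : ∀ a < i, allowed (c a i) (c a j) (c i j) = true) (h : Extends c T j i L) :
    Extends c T j (i + 1) (addEdge allowed j L i) := by
  obtain ⟨s, hs, hrows, hrow, hnd, hsub, hcol⟩ := h
  have hprev : s.rows.getD i [] = rowOf c i i := by simp [hrows, rowsOf, hij]
  have hsub' : ∀ x ∈ (List.zipWith (fun a b => Nat.add (Nat.add a b) (c i j)) (rowOf c i i)
      s.row).foldr insertNew s.types, x ∈ T := by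
    intro x hx
    rw [mem_foldr_insertNew] at hx
    rcases hx with hx | hx
    · rw [hrow] at hx
      simp only [rowOf, List.zipWith_map, List.zipWith_self, List.mem_map, List.mem_range] at hx
      obtain ⟨a, ha, rfl⟩ := hx
      exact hT' j hj i hij a ha
    · exact hsub x hx
  have hnd' := nodup_foldr_insertNew (List.zipWith (fun a b => Nat.add (Nat.add a b) (c i j))
    (rowOf c i i) s.row) s.types hnd
  refine ⟨⟨s.rows, s.row ++ [c i j], (List.zipWith (fun a b => Nat.add (Nat.add a b) (c i j))
    (rowOf c i i) s.row).foldr insertNew s.types, insertNew (c i j) s.colors⟩, ?_, hrows, ?_,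
    hnd', hsub', ?_⟩
  · unfold _root_.addEdge
    refine List.mem_flatMap.2 ⟨s, hs, List.mem_filterMap.2 ⟨c i j, ?_, ?_⟩⟩
    · rcases hc.labels j hj i hij with h | ⟨b, hb, a, hab, hlt, h⟩
      · rw [h]
        exact List.mem_cons_self
      · rw [← h]
        exact List.mem_cons_of_mem _ (hcol b hb a hab hlt)
    · have hlen : ((List.zipWith (fun a b => Nat.add (Nat.add a b) (c i j)) (rowOf c i i)
          s.row).foldr insertNew s.types).length ≤ 3 := by
        rw [← List.toFinset_card_of_nodup hnd']
        refine (Finset.card_le_card fun x hx => hsub' x (List.mem_toFinset.1 hx)).trans hT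
      have hall' : (List.zipWith (fun a b => allowed a b (c i j)) (rowOf c i i) s.row).all id
          = true := by
        rw [hrow]
        simpa [rowOf, List.zipWith_map, List.zipWith_self] using hall
      simp only [hprev, hall', Bool.and_true, Nat.ble_eq_true_of_le hlen, cond_true]
  · rw [hrow]
    simp [rowOf, List.range_succ]
  · intro b hb a hab hlt
    rw [mem_insertNew]
    rcases Nat.lt_succ_iff_lt_or_eq.1 (show edge a b < edge i j + 1 from hlt) with h | h
    · exact Or.inr (hcol b hb a hab h)
    · obtain ⟨rfl, rfl⟩ := edge_inj hab hb hij hj h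
      exact Or.inl rfl

theorem Extends.addVertex {c : ℕ → ℕ → ℕ} (hc : Admissible c) {T : Finset ℕ} (hT : T.card ≤ 3)
    (hT' : ∀ k < 6, ∀ j < k, ∀ i < j, c i j + c i k + c j k ∈ T)
    {allowed : ℕ → ℕ → ℕ → Bool} {j : ℕ} {L : List PartialColoring} (hj : j < 6)
    (hall : ∀ i < j, ∀ a < i, allowed (c a i) (c a j) (c i j) = true) (h : Extends c T j 0 L) :
    Extends c T (j + 1) 0 (addVertex allowed L j) := by
  have key : ∀ i ≤ j, Extends c T j i ((List.range i).foldl (_root_.addEdge allowed j) L) := by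
    intro i
    induction i with
    | zero => exact fun _ => h
    | succ i ih =>
      intro hi
      rw [List.range_succ, List.foldl_append]
      exact (ih (Nat.le_of_succ_le hi)).addEdge hc hT hT' hi hj (hall i hi)
  obtain ⟨s, hs, hrows, hrow, hnd, hsub, hcol⟩ := key j le_rfl
  have hrows' : s.rows ++ [s.row] = rowsOf c (j + 1) := by
    simp [hrows, hrow, rowsOf, List.range_succ]
  have hagree : ∀ i < j + 1, ∀ k < j + 1, color (rowsOf c (j + 1)) i k = c i k :=
    fun i hi k hk => color_rowsOf hc hi hk
  refine ⟨⟨s.rows ++ [s.row], [], s.types, s.colors⟩, ?_, hrows', by simp [rowOf], hnd, hsub, ?_⟩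
  · unfold _root_.addVertex
    refine List.mem_filter.2 ⟨List.mem_map.2 ⟨s, hs, rfl⟩, ?_⟩
    simp only [hrows']
    rw [hc.circles (j + 1) hj _ hagree, hc.ratios (j + 1) hj _ hagree]
    rfl
  · intro b hb a hab hlt
    refine hcol b hb a hab (hlt.trans_eq ?_)
    interval_cases j <;> rfl

theorem exists_mem_colorings {c : ℕ → ℕ → ℕ} (hc : Admissible c)
    {first other : ℕ → ℕ → ℕ → Bool} (h₁ : first (c 0 1) (c 0 2) (c 1 2) = true)
    (h₂ : ∀ k < 6, ∀ j < k, ∀ i < j, other (c i j) (c i k) (c j k) = true) :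
    ∃ s ∈ colorings first other, ∀ i < 6, ∀ j < 6, color s.rows i j = c i j := by
  obtain ⟨T, hT, hT'⟩ := hc.types
  have h0 : Extends c T 0 0 [⟨[], [], [], []⟩] :=
    ⟨_, List.mem_singleton_self _, rfl, rfl, List.nodup_nil, by simp, by simp [edge]⟩
  have h1 : Extends c T 1 0 (addVertex first _ 0) :=
    h0.addVertex hc hT hT' (by simp) (by simp)
  have h2 : Extends c T 2 0 (addVertex first _ 1) :=
    h1.addVertex hc hT hT' (by simp) (by simp)
  have h₁' : ∀ i < 2, ∀ a < i, first (c a i) (c a 2) (c i 2) = true := by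
    intro i hi a ha
    obtain rfl : i = 1 := by omega
    obtain rfl : a = 0 := by omega
    exact h₁
  have h3 : Extends c T 3 0 (addVertex first _ 2) := h2.addVertex hc hT hT' (by simp) h₁'
  have h4 : Extends c T 4 0 (addVertex other _ 3) := h3.addVertex hc hT hT' (by simp) (h₂ 3 (by simp))
  have h5 : Extends c T 5 0 (addVertex other _ 4) := h4.addVertex hc hT hT' (by simp) (h₂ 4 (by simp))
  have h6 : Extends c T 6 0 (addVertex other _ 5) := h5.addVertex hc hT hT' (by simp) (h₂ 5 (by simp))
  obtain ⟨s, hs, hrows, -⟩ := h6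
  refine ⟨s, ?_, fun i hi j hj => by rw [hrows]; exact color_rowsOf hc hi hj⟩
  simpa only [colorings, List.foldl_cons, List.foldl_nil] using hs

/-- For a set that spans at most three triangles, the sums over the sides of triangles of a function
of their lengths take at most three values. -/
theorem exists_finset_side_sums {S : Set Plane} (hS : (distinctTriangles S).encard ≤ 3)
    (f : ℝ → ℕ) (hf : f 0 = 0) :
    ∃ T : Finset ℕ, T.card ≤ 3 ∧ ∀ p ∈ S, ∀ q ∈ S, ∀ r ∈ S, p ≠ q → p ≠ r → q ≠ r →
      f (dist p q) + f (dist p r) + f (dist q r) ∈ T := by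
  let F : Triangle → ℕ := fun T => (∑ᶠ x ∈ T.1, ∑ᶠ y ∈ T.1, f (dist x y)) / 2
  have hF : ∀ T U : Triangle, triangleSetoid T U → F T = F U := by
    rintro T U ⟨e, he⟩
    simp only [F]
    rw [← he, finsum_mem_image e.injective.injOn]
    congr 1
    refine finsum_mem_congr rfl fun x _ => ?_
    rw [finsum_mem_image e.injective.injOn]
    simp only [e.dist_eq]
  let W : Set ℕ := Quotient.lift (s := triangleSetoid) F hF '' distinctTriangles S
  have hW : W.encard ≤ 3 := (Set.encard_image_le _ _).trans hS
  have hfin : W.Finite := Set.finite_of_encard_le_coe (k := 3) hW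
  refine ⟨hfin.toFinset, ?_, ?_⟩
  · rw [hfin.encard_eq_coe_toFinset_card] at hW
    exact_mod_cast hW
  · intro p hp q hq r hr hpq hpr hqr
    rw [hfin.mem_toFinset]
    have hcard : ({p, q, r} : Set Plane).encard = 3 := Set.encard_eq_three.2
      ⟨p, q, r, hpq, hpr, hqr, rfl⟩
    have hsub : ({p, q, r} : Set Plane) ⊆ S := by
      rintro x (rfl | rfl | rfl) <;> assumption
    refine ⟨Quotient.mk triangleSetoid ⟨{p, q, r}, hcard⟩, ⟨_, hsub, rfl⟩, ?_⟩
    have hsum : ∀ g : Plane → ℕ, ∑ᶠ x ∈ ({p, q, r} : Set Plane), g x = g p + (g q + g r) := by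
      intro g
      rw [finsum_mem_insert g (by simp [hpq, hpr]) (Set.toFinite _), finsum_mem_pair hqr]
    change (∑ᶠ x ∈ ({p, q, r} : Set Plane), ∑ᶠ y ∈ ({p, q, r} : Set Plane), f (dist x y)) / 2 = _
    simp only [hsum, dist_self, hf, dist_comm q p, dist_comm r p, dist_comm r q]
    omega

open Classical in
/-- Positive distances between the points `P 0`, ..., `P 5` are labelled by `4 ^ n`, where `n` is
the least position of an edge of that length; all other numbers are labelled by zero. -/
noncomputable def label (P : ℕ → Plane) (x : ℝ) : ℕ :=
  if h : ∃ n, ∃ b < 6, ∃ a < b, edge a b = n ∧ dist (P a) (P b) = x then 4 ^ Nat.find h else 0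

theorem exists_label_dist (P : ℕ → Plane) {i j : ℕ} (hij : i < j) (hj : j < 6) :
    ∃ b < 6, ∃ a < b, edge a b ≤ edge i j ∧ dist (P a) (P b) = dist (P i) (P j) ∧
      label P (dist (P i) (P j)) = 4 ^ edge a b := by
  have h : ∃ n, ∃ b < 6, ∃ a < b, edge a b = n ∧ dist (P a) (P b) = dist (P i) (P j) :=
    ⟨_, j, hj, i, hij, rfl, rfl⟩
  classical
  obtain ⟨b, hb, a, hab, he, hd⟩ := Nat.find_spec h
  refine ⟨b, hb, a, hab, ?_, hd, ?_⟩
  · rw [he]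
    exact Nat.find_min' h ⟨j, hj, i, hij, rfl, rfl⟩
  · rw [label, dif_pos h, he]
    congr!

theorem label_eq_zero {P : ℕ → Plane} (hP : ∀ i < 6, ∀ j < 6, P i = P j → i = j) :
    label P 0 = 0 := by
  rw [label, dif_neg]
  rintro ⟨n, b, hb, a, hab, -, hd⟩
  exact hab.ne (hP a (hab.trans hb) b hb (dist_eq_zero.1 hd))

theorem label_dist_ne_zero (P : ℕ → Plane) {i j : ℕ} (hij : i ≠ j) (hi : i < 6) (hj : j < 6) :
    label P (dist (P i) (P j)) ≠ 0 := by
  rcases hij.lt_or_gt with h | h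
  · obtain ⟨b, -, a, -, -, -, h⟩ := exists_label_dist P h hj
    rw [h]; positivity
  · obtain ⟨b, -, a, -, -, -, h⟩ := exists_label_dist P h hi
    rw [dist_comm, h]; positivity

theorem dist_eq_of_label_eq_of_lt {P : ℕ → Plane} {i j k l : ℕ} (hij : i < j) (hj : j < 6)
    (hkl : k < l) (hl : l < 6) (h : label P (dist (P i) (P j)) = label P (dist (P k) (P l))) :
    dist (P i) (P j) = dist (P k) (P l) := by
  obtain ⟨b, hb, a, hab, -, hd, hlab⟩ := exists_label_dist P hij hj
  obtain ⟨b', hb', a', hab', -, hd', hlab'⟩ := exists_label_dist P hkl hl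
  rw [hlab, hlab'] at h
  obtain ⟨rfl, rfl⟩ := edge_inj hab hb hab' hb' (Nat.pow_right_injective (by norm_num : 2 ≤ 4) h)
  rw [← hd, hd']

theorem dist_eq_of_label_eq {P : ℕ → Plane} (hP : ∀ i < 6, ∀ j < 6, P i = P j → i = j)
    {i j k l : ℕ} (hi : i < 6) (hj : j < 6) (hk : k < 6) (hl : l < 6)
    (h : label P (dist (P i) (P j)) = label P (dist (P k) (P l))) :
    dist (P i) (P j) = dist (P k) (P l) := by
  rcases lt_trichotomy i j with h1 | rfl | h1 <;> rcases lt_trichotomy k l with h2 | rfl | h2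
  · exact dist_eq_of_label_eq_of_lt h1 hj h2 hl h
  · rw [dist_self, label_eq_zero hP] at h
    exact absurd h (label_dist_ne_zero P h1.ne hi hj)
  · rw [dist_comm (P k)] at h ⊢
    exact dist_eq_of_label_eq_of_lt h1 hj h2 hk h
  · rw [dist_self, label_eq_zero hP] at h
    exact absurd h.symm (label_dist_ne_zero P h2.ne hk hl)
  · simp
  · rw [dist_self, label_eq_zero hP] at h
    exact absurd h.symm (label_dist_ne_zero P h2.ne' hk hl)
  · rw [dist_comm (P i)] at h ⊢
    exact dist_eq_of_label_eq_of_lt h1 hi h2 hl h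
  · rw [dist_self, label_eq_zero hP] at h
    exact absurd h (label_dist_ne_zero P h1.ne' hi hj)
  · rw [dist_comm (P i), dist_comm (P k)] at h ⊢
    exact dist_eq_of_label_eq_of_lt h1 hi h2 hk h

/-- Three distinct points do not all have the same distance from each of two distinct points. -/
theorem not_dist_eq_three {p q x y z : Plane} (hpq : p ≠ q) (hxy : x ≠ y) (hxz : x ≠ z)
    (hyz : y ≠ z) (h₁ : dist p x = dist p y) (h₂ : dist p y = dist p z)
    (h₃ : dist q x = dist q y) (h₄ : dist q y = dist q z) : False := by
  rcases EuclideanGeometry.eq_of_dist_eq_of_dist_eq_of_finrank_eq_two (c₁ := p) (c₂ := q)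
    (p₁ := x) (p₂ := y) (p := z) (r₁ := dist p z) (r₂ := dist q z) (by simp) hpq hxy
    (by rw [dist_comm, h₁, h₂]) (by rw [dist_comm, h₂]) (dist_comm _ _)
    (by rw [dist_comm, h₃, h₄]) (by rw [dist_comm, h₄]) (dist_comm _ _) with h | h
  · exact hxz h.symm
  · exact hyz h.symm

theorem noCommonCircles_label {P : ℕ → Plane} (hP : ∀ i < 6, ∀ j < 6, P i = P j → i = j)
    {n : ℕ} (hn : n ≤ 6) {c : ℕ → ℕ → ℕ}
    (hc : ∀ i < n, ∀ j < n, c i j = label P (dist (P i) (P j))) : noCommonCircles c n = true := by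
  unfold noCommonCircles
  simp only [List.all_eq_true]
  rintro ⟨p, q⟩ hpq ⟨x, y, z⟩ ht
  rw [mem_pairs] at hpq
  rw [mem_triples] at ht
  obtain ⟨hpq, hq⟩ := hpq
  obtain ⟨hxy, hyz, hz⟩ := ht
  simp only at hpq hq hxy hyz hz ⊢
  have hne : ∀ i j, i < j → j < n → P i ≠ P j := fun i j hij hj h =>
    hij.ne (hP i (by omega) j (by omega) h)
  rw [Bool.not_eq_true', Bool.eq_false_iff]
  intro h
  simp only [Bool.and_eq_true, Nat.beq_eq] at h
  obtain ⟨⟨⟨h1, h2⟩, h3⟩, h4⟩ := h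
  have key : ∀ i j k, i < n → j < n → k < n → c i j = c i k →
      dist (P i) (P j) = dist (P i) (P k) := by
    intro i j k hi hj hk h
    rw [hc i hi j hj, hc i hi k hk] at h
    exact dist_eq_of_label_eq hP (by omega) (by omega) (by omega) (by omega) h
  exact not_dist_eq_three (hne p q hpq hq) (hne x y hxy (by omega)) (hne x z (by omega) hz)
    (hne y z hyz hz) (key _ _ _ (by omega) (by omega) (by omega) h1)
    (key _ _ _ (by omega) (by omega) (by omega) h2)
    (key _ _ _ (by omega) (by omega) (by omega) h3)
    (key _ _ _ (by omega) (by omega) (by omega) h4)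

/-- A ratio code `(a, b, m)` is realized by two distances of points with labels `a` and `b`. -/
def Realized (P : ℕ → Plane) (x : ℕ × ℕ × ℕ) : Prop :=
  ∃ i < 6, ∃ j < 6, ∃ k < 6, ∃ l < 6, i ≠ j ∧ k ≠ l ∧ label P (dist (P i) (P j)) = x.1 ∧
    label P (dist (P k) (P l)) = x.2.1 ∧
    6 * ((dist (P i) (P j) ^ 2) ^ 2 + (dist (P k) (P l) ^ 2) ^ 2) =
      x.2.2 * (dist (P i) (P j) ^ 2 * dist (P k) (P l) ^ 2)

theorem Nat.not_beq_eq_true {a b : ℕ} : (!Nat.beq a b) = true ↔ a ≠ b := by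
  rw [Bool.not_eq_true', Bool.eq_false_iff, ne_eq, Nat.beq_eq]

theorem ratioCode_ofFn {f : Fin 6 → ℕ} {x : ℕ × ℕ × ℕ}
    (h : ratioCode (List.ofFn f) = some x) :
    (∀ i, f i = f 0) ∨ ∃ k, f k ≠ f 0 ∧ (∀ i, f i = f 0 ∨ f i = f k) ∧
      x = (f 0, f k, ratioCoeff fun i => Nat.beq (f i) (f 0)) := by
  by_cases hall : ∀ i, f i = f 0
  · exact Or.inl hall
  right
  have h0 : (List.ofFn f).getD 0 0 = f 0 := by simp
  have hget : (fun i : Fin 6 => Nat.beq ((List.ofFn f).getD i 0) (f 0)) =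
      fun i => Nat.beq (f i) (f 0) := by
    funext i
    rw [List.getD_eq_getElem _ _ (by simp), List.getElem_ofFn]
  obtain ⟨k, hk⟩ : ∃ k, (List.ofFn f).find? (fun x => !Nat.beq x (f 0)) = some (f k) := by
    obtain ⟨i, hi⟩ := not_forall.1 hall
    have : ((List.ofFn f).find? fun x => !Nat.beq x (f 0)).isSome := by
      rw [List.find?_isSome]
      exact ⟨f i, List.mem_ofFn.2 ⟨i, rfl⟩, Nat.not_beq_eq_true.2 hi⟩
    obtain ⟨y, hy⟩ := Option.isSome_iff_exists.1 this
    obtain ⟨k, rfl⟩ : ∃ k, f k = y := List.mem_ofFn.1 (List.mem_of_find?_eq_some hy)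
    exact ⟨k, hy⟩
  have hk' := List.find?_some hk
  simp only [ratioCode, h0, hk, hget, Option.getD_some] at h
  cases hcond : (List.ofFn f).all fun x => Nat.beq x (f 0) || Nat.beq x (f k)
  · rw [hcond] at h
    exact absurd h (by simp)
  · rw [hcond] at h
    refine ⟨k, Nat.not_beq_eq_true.1 hk', fun i => ?_, (Option.some_injective _ h).symm⟩
    simpa using List.all_eq_true.1 hcond (f i) (List.mem_ofFn.2 ⟨i, rfl⟩)

theorem realized_of_ratioCode {P : ℕ → Plane} (hP : ∀ i < 6, ∀ j < 6, P i = P j → i = j)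
    {c : ℕ → ℕ → ℕ} {q : ℕ × ℕ × ℕ × ℕ} (hq : q ∈ quads 6)
    (hc : quadColors c q = quadColors (fun i j => label P (dist (P i) (P j))) q)
    {x : ℕ × ℕ × ℕ} (hx : ratioCode (quadColors c q) = some x) : Realized P x := by
  obtain ⟨q₀, q₁, q₂, q₃⟩ := q
  rw [mem_quads] at hq
  simp only at hq
  obtain ⟨h01, h12, h23, h3⟩ := hq
  rw [hc] at hx
  have hgram := gramDet_eq_zero (P q₀) (P q₁) (P q₂) (P q₃)
  set e : Fin 6 → ℕ × ℕ := ![(q₀, q₁), (q₀, q₂), (q₁, q₂), (q₀, q₃), (q₁, q₃), (q₂, q₃)] with he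
  set δ : Fin 6 → ℝ := fun i => dist (P (e i).1) (P (e i).2) with hδ
  have he_lt : ∀ i, (e i).1 < (e i).2 ∧ (e i).2 < 6 := by
    intro i
    fin_cases i <;> simp [he] <;> omega
  have hpos : ∀ i, 0 < δ i := fun i => dist_pos.2 fun h =>
    (he_lt i).1.ne (hP _ ((he_lt i).1.trans (he_lt i).2) _ (he_lt i).2 h)
  have hne0 : ∀ i, label P (δ i) ≠ 0 := fun i =>
    label_dist_ne_zero P (he_lt i).1.ne ((he_lt i).1.trans (he_lt i).2) (he_lt i).2
  have hinj : ∀ i j, label P (δ i) = label P (δ j) → δ i = δ j := fun i j h =>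
    dist_eq_of_label_eq hP ((he_lt i).1.trans (he_lt i).2) (he_lt i).2
      ((he_lt j).1.trans (he_lt j).2) (he_lt j).2 h
  have hl : quadColors (fun i j => label P (dist (P i) (P j))) (q₀, q₁, q₂, q₃) =
      List.ofFn fun i => label P (δ i) := by
    simp [quadColors, hδ, he, List.ofFn_succ]
  have hg : gramDet (δ 0 ^ 2) (δ 1 ^ 2) (δ 2 ^ 2) (δ 3 ^ 2) (δ 4 ^ 2) (δ 5 ^ 2) = 0 := hgram
  rw [hl] at hx
  rcases ratioCode_ofFn hx with hmono | ⟨k, hk, htwo, rfl⟩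
  · have hδ0 : ∀ i, δ i = δ 0 := fun i => hinj _ _ (hmono i)
    rw [hδ0 1, hδ0 2, hδ0 3, hδ0 4, hδ0 5] at hg
    have : 4 * (δ 0 ^ 2) ^ 3 = 0 := by
      rw [← hg, gramDet]
      ring
    have := hpos 0
    exact absurd ‹4 * (δ 0 ^ 2) ^ 3 = 0› (by positivity)
  · have hsq : ∀ i, δ i ^ 2 =
        cond (Nat.beq (label P (δ i)) (label P (δ 0))) (δ 0 ^ 2) (δ k ^ 2) := by
      intro i
      cases hb : Nat.beq (label P (δ i)) (label P (δ 0))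
      · rcases htwo i with h | h
        · rw [h, Nat.beq_refl] at hb
          exact absurd hb (by simp)
        · rw [hinj _ _ h, cond_false]
      · rw [hinj _ _ (Nat.eq_of_beq_eq_true hb), cond_true]
    have hlt := fun i => (he_lt i).1.trans (he_lt i).2
    rw [hsq 0, hsq 1, hsq 2, hsq 3, hsq 4, hsq 5] at hg
    have hr := ratio_of_gramDet (δ 0 ^ 2) (δ k ^ 2) (pow_pos (hpos 0) 2) (pow_pos (hpos k) 2)
      (fun i => Nat.beq (label P (δ i)) (label P (δ 0))) ⟨0, k, by simpa using hk⟩ hg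
    generalize ratioCoeff _ = m at hr ⊢
    exact ⟨_, hlt 0, _, (he_lt 0).2, _, hlt k, _, (he_lt k).2, (he_lt 0).1.ne, (he_lt k).1.ne,
      rfl, rfl, hr⟩

theorem Realized.ne_zero {P : ℕ → Plane} {x : ℕ × ℕ × ℕ} (hx : Realized P x) : x.2.1 ≠ 0 := by
  obtain ⟨i, hi, j, hj, k, hk, l, hl, hij, hkl, h₁, h₂, h₃⟩ := hx
  rw [← h₂]
  exact label_dist_ne_zero P hkl hk hl

theorem Realized.eq {P : ℕ → Plane} (hP : ∀ i < 6, ∀ j < 6, P i = P j → i = j)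
    {x y : ℕ × ℕ × ℕ} (hx : Realized P x) (hy : Realized P y)
    (h : (x.1 = y.1 ∧ x.2.1 = y.2.1) ∨ (x.1 = y.2.1 ∧ x.2.1 = y.1)) : x.2.2 = y.2.2 := by
  obtain ⟨i, hi, j, hj, k, hk, l, hl, hij, hkl, h₁, h₂, h₃⟩ := hx
  obtain ⟨i', hi', j', hj', k', hk', l', hl', hij', hkl', h₁', h₂', h₃'⟩ := hy
  have hpos : 0 < dist (P i) (P j) ^ 2 * dist (P k) (P l) ^ 2 := by
    have h1 := dist_pos.2 fun h => hij (hP i hi j hj h)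
    have h2 := dist_pos.2 fun h => hkl (hP k hk l hl h)
    positivity
  have : (x.2.2 : ℝ) * (dist (P i) (P j) ^ 2 * dist (P k) (P l) ^ 2) =
      y.2.2 * (dist (P i) (P j) ^ 2 * dist (P k) (P l) ^ 2) := by
    rw [← h₁, ← h₂, ← h₁', ← h₂'] at h
    rcases h with ⟨e₁, e₂⟩ | ⟨e₁, e₂⟩
    · have d₁ := dist_eq_of_label_eq hP hi hj hi' hj' e₁
      have d₂ := dist_eq_of_label_eq hP hk hl hk' hl' e₂
      rw [← d₁, ← d₂] at h₃'
      linarith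
    · have d₁ := dist_eq_of_label_eq hP hi hj hk' hl' e₁
      have d₂ := dist_eq_of_label_eq hP hk hl hi' hj' e₂
      rw [← d₁, ← d₂] at h₃'
      linarith
  exact_mod_cast mul_right_cancel₀ hpos.ne' this

theorem ratiosConsistent_label {P : ℕ → Plane} (hP : ∀ i < 6, ∀ j < 6, P i = P j → i = j)
    {n : ℕ} (hn : n ≤ 6) {c : ℕ → ℕ → ℕ}
    (hc : ∀ i < n, ∀ j < n, c i j = label P (dist (P i) (P j))) :
    ratiosConsistent c n = true := by
  have key : ∀ x ∈ (quads n).filterMap fun q => ratioCode (quadColors c q), Realized P x := by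
    intro x hx
    obtain ⟨⟨a, b, d, e⟩, hq, hx⟩ := List.mem_filterMap.1 hx
    rw [mem_quads] at hq
    simp only at hq
    obtain ⟨h1, h2, h3, h4⟩ := hq
    refine realized_of_ratioCode hP (mem_quads.2 ⟨h1, h2, h3, h4.trans_le hn⟩) ?_ hx
    simp only [quadColors]
    rw [hc a (by omega) b (by omega), hc a (by omega) d (by omega), hc b (by omega) d (by omega),
      hc a (by omega) e (by omega), hc b (by omega) e (by omega), hc d (by omega) e (by omega)]
  unfold ratiosConsistent
  simp only [List.all_eq_true, Bool.and_eq_true, Bool.or_eq_true, Bool.not_eq_true']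
  intro x hx
  refine ⟨?_, fun y hy => ?_⟩
  · rw [Bool.eq_false_iff]
    exact fun h => (key x hx).ne_zero (Nat.eq_of_beq_eq_true h)
  · rw [Bool.eq_false_iff, Nat.beq_eq, ← imp_iff_not_or]
    intro h
    simp only [Bool.or_eq_true, Bool.and_eq_true, Nat.beq_eq] at h
    exact (key x hx).eq hP (key y hy) h

theorem admissible_label {P : ℕ → Plane} (hP : ∀ i < 6, ∀ j < 6, P i = P j → i = j) {S : Set Plane}
    (hS : (distinctTriangles S).encard ≤ 3) (hPS : ∀ i < 6, P i ∈ S) :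
    Admissible fun i j => label P (dist (P i) (P j)) where
  symm i j := by rw [dist_comm]
  diag i := by rw [dist_self, label_eq_zero hP]
  labels j hj i hij := by
    obtain ⟨b, hb, a, hab, hle, hd, hlab⟩ := exists_label_dist P hij hj
    rcases hle.lt_or_eq with h | h
    · exact Or.inr ⟨b, hb, a, hab, h, by rw [hd]⟩
    · exact Or.inl (by rw [hlab, h])
  types := by
    obtain ⟨T, hT, h⟩ := exists_finset_side_sums hS (label P) (label_eq_zero hP)
    refine ⟨T, hT, fun k hk j hj i hi => h _ (hPS i (by omega)) _ (hPS j (by omega)) _ (hPS k hk)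
      ?_ ?_ ?_⟩
    · exact fun h => hi.ne (hP i (by omega) j (by omega) h)
    · exact fun h => (hi.trans hj).ne (hP i (by omega) k hk h)
    · exact fun h => hj.ne (hP j (by omega) k hk h)
  circles n hn c' hc' := noCommonCircles_label hP hn hc'
  ratios n hn c' hc' := ratiosConsistent_label hP hn hc'

/-- Any three points of a set of six points are the first three points of an enumeration. -/
theorem exists_enumeration {S : Set Plane} (hS : S.encard = 6) {A B C : Plane} (hA : A ∈ S)
    (hB : B ∈ S) (hC : C ∈ S) (hAB : A ≠ B) (hAC : A ≠ C) (hBC : B ≠ C) :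
    ∃ P : ℕ → Plane, P 0 = A ∧ P 1 = B ∧ P 2 = C ∧ (∀ i < 6, ∀ j < 6, P i = P j → i = j) ∧
      S = {P 0, P 1, P 2, P 3, P 4, P 5} := by
  have h3 : ({A, B, C} : Set Plane).encard = 3 := Set.encard_eq_three.2
    ⟨A, B, C, hAB, hAC, hBC, rfl⟩
  have hsub : ({A, B, C} : Set Plane) ⊆ S := by
    rintro x (rfl | rfl | rfl) <;> assumption
  have hdiff : (S \ {A, B, C}).encard = 3 := by
    rw [Set.encard_sdiff hsub (Set.toFinite _), hS, h3]
    rfl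
  obtain ⟨D, E, F, hDE, hDF, hEF, hDEF⟩ := Set.encard_eq_three.1 hdiff
  have hout : ∀ X ∈ ({D, E, F} : Set Plane), X ≠ A ∧ X ≠ B ∧ X ≠ C := by
    intro X hX
    rw [← hDEF] at hX
    simpa using hX.2
  obtain ⟨hDA, hDB, hDC⟩ := hout D (by simp)
  obtain ⟨hEA, hEB, hEC⟩ := hout E (by simp)
  obtain ⟨hFA, hFB, hFC⟩ := hout F (by simp)
  refine ⟨fun n => [A, B, C, D, E, F].getD n 0, rfl, rfl, rfl, ?_, ?_⟩
  · have hnd : [A, B, C, D, E, F].Nodup := by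
      simp [hAB, hAC, hBC, hDE, hDF, hEF, hDA.symm, hDB.symm, hDC.symm, hEA.symm, hEB.symm,
        hEC.symm, hFA.symm, hFB.symm, hFC.symm]
    intro i hi j hj h
    simp only at h
    rw [List.getD_eq_getElem _ _ (show i < [A, B, C, D, E, F].length from hi),
      List.getD_eq_getElem _ _ (show j < [A, B, C, D, E, F].length from hj)]
      at h
    exact (hnd.getElem_inj_iff).1 h
  · rw [← Set.union_sdiff_cancel hsub, hDEF]
    ext X
    simp only [Set.mem_union, Set.mem_insert_iff, Set.mem_singleton_iff, or_assoc]
    rfl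

/-- The distances of a regular hexagon with equilateral triangles `(a, b, c)` and `(x, y, z)`, in
which `x`, `y`, `z` are opposite to `a`, `b`, `c`. -/
structure HasHexagonDistances (a b c x y z : Plane) : Prop where
  ne : a ≠ b
  ne_x : x ≠ a
  ac : dist a c = dist a b
  bc : dist b c = dist a b
  xy : dist x y = dist a b
  xz : dist x z = dist a b
  yz : dist y z = dist a b
  az : dist a z = dist a y
  bx : dist b x = dist a y
  bz : dist b z = dist a y
  cx : dist c x = dist a y
  cy : dist c y = dist a y
  bY : dist b y = dist a x
  cZ : dist c z = dist a x

theorem isHexagonColoring_iff {c : ℕ → ℕ → ℕ} {x y z : ℕ} : isHexagonColoring c x y z = true ↔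
    (c 0 1 = c 0 2 ∧ c 0 1 = c 1 2 ∧ c 0 1 = c x y ∧ c 0 1 = c x z ∧ c 0 1 = c y z) ∧
    (c 0 y = c 0 z ∧ c 0 y = c 1 x ∧ c 0 y = c 1 z ∧ c 0 y = c 2 x ∧ c 0 y = c 2 y) ∧
    (c 0 x = c 1 y ∧ c 0 x = c 2 z) := by
  simp only [isHexagonColoring, List.all_cons, List.all_nil, Bool.and_true, Bool.and_eq_true,
    Nat.beq_eq, and_assoc]

theorem exists_isHexagonColoring {s : PartialColoring}
    (hs : s ∈ colorings isMono fun _ _ _ => true) :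
    ∃ t ∈ [(3, 4, 5), (3, 5, 4), (4, 3, 5), (4, 5, 3), (5, 3, 4), (5, 4, 3)],
      isHexagonColoring (color s.rows) t.1 t.2.1 t.2.2 = true :=
  List.any_eq_true.1 (List.all_eq_true.1 colorings_mono s hs)

theorem exists_hexagonDistances {S : Set Plane} (hS : S.encard = 6)
    (hT : (distinctTriangles S).encard ≤ 3) :
    ∃ a b c x y z, S = {a, b, c, x, y, z} ∧ HasHexagonDistances a b c x y z := by
  have key : ∀ {first other : ℕ → ℕ → ℕ → Bool} {P : ℕ → Plane},
      (∀ i < 6, ∀ j < 6, P i = P j → i = j) → S = {P 0, P 1, P 2, P 3, P 4, P 5} →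
      first (label P (dist (P 0) (P 1))) (label P (dist (P 0) (P 2)))
        (label P (dist (P 1) (P 2))) = true →
      (∀ k < 6, ∀ j < k, ∀ i < j, other (label P (dist (P i) (P j)))
        (label P (dist (P i) (P k))) (label P (dist (P j) (P k))) = true) →
      ∃ s ∈ colorings first other, ∀ i < 6, ∀ j < 6,
        color s.rows i j = label P (dist (P i) (P j)) := by
    intro first other P hP hPS h₁ h₂
    refine exists_mem_colorings (admissible_label hP hT fun i hi => ?_) h₁ h₂
    rw [hPS]
    interval_cases i <;> simp
  have hempty : ∀ {first other : ℕ → ℕ → ℕ → Bool} {Q : PartialColoring → Prop},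
      (colorings first other).isEmpty = true → (∃ s ∈ colorings first other, Q s) → False := by
    rintro first other Q h ⟨s, hs, -⟩
    rw [List.isEmpty_iff.1 h] at hs
    exact List.not_mem_nil hs
  by_cases hmono : ∃ a ∈ S, ∃ b ∈ S, ∃ c ∈ S, a ≠ b ∧ a ≠ c ∧ b ≠ c ∧
      dist a b = dist a c ∧ dist a c = dist b c
  · obtain ⟨a, ha, b, hb, c, hc, hab, hac, hbc, h1, h2⟩ := hmono
    obtain ⟨P, rfl, rfl, rfl, hP, hPS⟩ := exists_enumeration hS ha hb hc hab hac hbc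
    obtain ⟨s, hs, hcol⟩ := key (first := isMono) (other := fun _ _ _ => true) hP hPS
      (by simp [isMono, h1, h2]) (by simp)
    obtain ⟨⟨x, y, z⟩, ht, hhex⟩ := exists_isHexagonColoring hs
    rw [isHexagonColoring_iff] at hhex
    simp only [List.mem_cons, Prod.mk.injEq, List.not_mem_nil, or_false] at ht hhex
    have hlt : (0 < x ∧ x < 6) ∧ y < 6 ∧ z < 6 := by omega
    obtain ⟨⟨hx0, hx⟩, hy, hz⟩ := hlt
    have h0 : 0 < 6 := by norm_num
    have h1 : 1 < 6 := by norm_num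
    have h2 : 2 < 6 := by norm_num
    refine ⟨P 0, P 1, P 2, P x, P y, P z, ?_, ?_⟩
    · rw [hPS]
      clear hhex hcol hs key hempty hP hPS
      ext X
      rcases ht with ⟨rfl, rfl, rfl⟩ | ⟨rfl, rfl, rfl⟩ | ⟨rfl, rfl, rfl⟩ | ⟨rfl, rfl, rfl⟩ |
        ⟨rfl, rfl, rfl⟩ | ⟨rfl, rfl, rfl⟩ <;> simp only [Set.mem_insert_iff, Set.mem_singleton_iff] <;>
        constructor <;> rintro (h | h | h | h | h | h) <;> simp only [h, true_or, or_true]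
    · have hd : ∀ {i j k l}, i < 6 → j < 6 → k < 6 → l < 6 →
          color s.rows k l = color s.rows i j → dist (P i) (P j) = dist (P k) (P l) := by
        intro i j k l hi hj hk hl h
        rw [hcol i hi j hj, hcol k hk l hl] at h
        exact dist_eq_of_label_eq hP hi hj hk hl h.symm
      obtain ⟨⟨a1, a2, a3, a4, a5⟩, ⟨b1, b2, b3, b4, b5⟩, c1, c2⟩ := hhex
      exact ⟨hab, fun h => hx0.ne' (hP x hx 0 h0 h), hd h0 h2 h0 h1 a1, hd h1 h2 h0 h1 a2,
        hd hx hy h0 h1 a3, hd hx hz h0 h1 a4, hd hy hz h0 h1 a5, hd h0 hz h0 hy b1,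
        hd h1 hx h0 hy b2, hd h1 hz h0 hy b3, hd h2 hx h0 hy b4, hd h2 hy h0 hy b5,
        hd h1 hy h0 hx c1, hd h2 hz h0 hx c2⟩
  exfalso
  have hmem : ∀ {P : ℕ → Plane}, S = {P 0, P 1, P 2, P 3, P 4, P 5} → ∀ i < 6, P i ∈ S := by
    intro P hPS i hi
    rw [hPS]
    interval_cases i <;> simp
  by_cases hiso : ∃ a ∈ S, ∃ b ∈ S, ∃ c ∈ S, a ≠ b ∧ a ≠ c ∧ b ≠ c ∧ dist a b = dist a c
  · obtain ⟨a, ha, b, hb, c, hc, hab, hac, hbc, h1⟩ := hiso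
    obtain ⟨P, rfl, rfl, rfl, hP, hPS⟩ := exists_enumeration hS ha hb hc hab hac hbc
    have hall : ∀ k < 6, ∀ j < k, ∀ i < j, (!isMono (label P (dist (P i) (P j)))
        (label P (dist (P i) (P k))) (label P (dist (P j) (P k)))) = true := by
      intro k hk j hj i hi
      rw [Bool.not_eq_true', Bool.eq_false_iff]
      simp only [isMono, ne_eq, Bool.and_eq_true, Nat.beq_eq]
      rintro ⟨e1, e2⟩
      exact hmono ⟨_, hmem hPS i (by omega), _, hmem hPS j (by omega), _, hmem hPS k hk,
        fun h => hi.ne (hP _ (by omega) _ (by omega) h),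
        fun h => (hi.trans hj).ne (hP _ (by omega) _ (by omega) h),
        fun h => hj.ne (hP _ (by omega) _ (by omega) h),
        dist_eq_of_label_eq hP (by omega) (by omega) (by omega) (by omega) e1,
        dist_eq_of_label_eq hP (by omega) (by omega) (by omega) (by omega) e2⟩
    refine hempty colorings_isosceles (key hP hPS ?_ hall)
    have := hall 2 (by simp) 1 (by simp) 0 (by simp)
    simpa [isMono, isIsosceles, h1] using this
  · obtain ⟨U, hUS, hU⟩ := Set.exists_subset_encard_eq (s := S) (k := 3) (by rw [hS]; decide)
    obtain ⟨a, b, c, hab, hac, hbc, rfl⟩ := Set.encard_eq_three.1 hU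
    obtain ⟨P, rfl, rfl, rfl, hP, hPS⟩ := exists_enumeration hS (hUS (by simp)) (hUS (by simp))
      (hUS (by simp)) hab hac hbc
    have hne : ∀ i < 6, ∀ j < 6, ∀ k < 6, i ≠ j → i ≠ k → j ≠ k →
        label P (dist (P i) (P j)) ≠ label P (dist (P i) (P k)) :=
      fun i hi j hj k hk hij hik hjk h => hiso ⟨_, hmem hPS i hi, _, hmem hPS j hj, _,
        hmem hPS k hk, fun h => hij (hP _ hi _ hj h), fun h => hik (hP _ hi _ hk h),
        fun h => hjk (hP _ hj _ hk h), dist_eq_of_label_eq hP hi hj hi hk h⟩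
    have hall : ∀ k < 6, ∀ j < k, ∀ i < j, isScalene (label P (dist (P i) (P j)))
        (label P (dist (P i) (P k))) (label P (dist (P j) (P k))) = true := by
      intro k hk j hj i hi
      have hj6 := hj.trans hk
      have hi6 := hi.trans hj6
      have hik := hi.trans hj
      have h1 := hne i hi6 j hj6 k hk hi.ne hik.ne hj.ne
      have h2 := hne k hk i hi6 j hj6 hik.ne' hj.ne' hi.ne
      have h3 := hne j hj6 i hi6 k hk hi.ne' hj.ne hik.ne
      rw [dist_comm (P k), dist_comm (P k)] at h2
      rw [dist_comm (P j) (P i)] at h3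
      rw [isScalene, Bool.not_eq_true', Bool.eq_false_iff]
      simp only [ne_eq, Bool.or_eq_true, Nat.beq_eq]
      rintro ((h | h) | h)
      exacts [h1 h, h2 h, h3 h]
    exact hempty colorings_scalene (key hP hPS (hall 2 (by simp) 1 (by simp) 0 (by simp)) hall)

/-- The point on the circle with centre `c` and radius `r` in the direction `θ + t * (π / 3)`. -/
noncomputable def hexVertex (c : Plane) (r θ t : ℝ) : Plane :=
  c + r • !₂[Real.cos (θ + t * (Real.pi / 3)), Real.sin (θ + t * (Real.pi / 3))]

theorem hexVertex_apply_zero (c : Plane) (r θ t : ℝ) :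
    hexVertex c r θ t 0 = c 0 + r * Real.cos (θ + t * (Real.pi / 3)) := by
  simp [hexVertex]

theorem hexVertex_apply_one (c : Plane) (r θ t : ℝ) :
    hexVertex c r θ t 1 = c 1 + r * Real.sin (θ + t * (Real.pi / 3)) := by
  simp [hexVertex]

theorem plane_ext {p q : Plane} (h₀ : p 0 = q 0) (h₁ : p 1 = q 1) : p = q := by
  ext i
  fin_cases i
  · exact h₀
  · exact h₁

/-- An equilateral triangle with centroid `0` is determined by one vertex up to orientation. -/
theorem equilateral_coordinates {u₀ u₁ v₀ v₁ A : ℝ} (hA : 0 < A)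
    (h₁ : (u₀ - v₀) ^ 2 + (u₁ - v₁) ^ 2 = A) (h₂ : (2 * u₀ + v₀) ^ 2 + (2 * u₁ + v₁) ^ 2 = A)
    (h₃ : (u₀ + 2 * v₀) ^ 2 + (u₁ + 2 * v₁) ^ 2 = A) :
    3 * (u₀ ^ 2 + u₁ ^ 2) = A ∧
      ∃ t : ℝ, t ^ 2 = 3 / 4 ∧ v₀ = -u₀ / 2 - t * u₁ ∧ v₁ = -u₁ / 2 + t * u₀ := by
  have hR : 3 * (u₀ ^ 2 + u₁ ^ 2) = A := by linear_combination 2 / 3 * h₁ + 2 / 3 * h₂ - 1 / 3 * h₃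
  have hU : u₀ ^ 2 + u₁ ^ 2 ≠ 0 := by
    intro h
    rw [h] at hR
    linarith
  have hD : 2 * (u₀ * v₀ + u₁ * v₁) + (u₀ ^ 2 + u₁ ^ 2) = 0 := by
    linear_combination (h₂ - h₁) / 3
  have hV : v₀ ^ 2 + v₁ ^ 2 = u₀ ^ 2 + u₁ ^ 2 := by linear_combination (h₃ - h₂) / 3
  refine ⟨hR, (u₀ * v₁ - u₁ * v₀) / (u₀ ^ 2 + u₁ ^ 2), ?_, ?_, ?_⟩
  · field_simp
    linear_combination 4 * (u₀ ^ 2 + u₁ ^ 2) * hV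
      - (2 * (u₀ * v₀ + u₁ * v₁) - (u₀ ^ 2 + u₁ ^ 2)) * hD
  · field_simp
    linear_combination u₀ * hD
  · field_simp
    linear_combination u₁ * hD

/-- A point with equal distances from `p = -u / 2 + t * J u` and `q = -u / 2 - t * J u`, where `J`
is the quarter turn, is a multiple of `u`. -/
theorem exists_eq_mul_of_equidistant {u₀ u₁ x₀ x₁ p₀ p₁ q₀ q₁ t : ℝ} (ht : t ≠ 0)
    (hu : u₀ ^ 2 + u₁ ^ 2 ≠ 0) (hp₀ : p₀ = -u₀ / 2 - t * u₁) (hp₁ : p₁ = -u₁ / 2 + t * u₀)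
    (hq₀ : q₀ = -u₀ / 2 + t * u₁) (hq₁ : q₁ = -u₁ / 2 - t * u₀)
    (h : (p₀ - x₀) ^ 2 + (p₁ - x₁) ^ 2 = (q₀ - x₀) ^ 2 + (q₁ - x₁) ^ 2) :
    ∃ s, x₀ = s * u₀ ∧ x₁ = s * u₁ := by
  subst hp₀ hp₁ hq₀ hq₁
  have hx : x₀ * u₁ = x₁ * u₀ := by
    have : t * (x₀ * u₁ - x₁ * u₀) = 0 := by linear_combination h / 4
    have := (mul_eq_zero.1 this).resolve_left ht
    linarith
  refine ⟨(x₀ * u₀ + x₁ * u₁) / (u₀ ^ 2 + u₁ ^ 2), ?_, ?_⟩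
  · field_simp
    linear_combination u₁ * hx
  · field_simp
    linear_combination -u₀ * hx

/-- The coordinates of the vertices of a regular hexagon in terms of the centre and one vertex. -/
theorem HasHexagonDistances.coordinates {a b c x y z : Plane}
    (h : HasHexagonDistances a b c x y z) :
    ∃ (o : Plane) (t : ℝ), t ^ 2 = 3 / 4 ∧ 0 < (a 0 - o 0) ^ 2 + (a 1 - o 1) ^ 2 ∧
      b 0 = o 0 - (a 0 - o 0) / 2 - t * (a 1 - o 1) ∧
      b 1 = o 1 - (a 1 - o 1) / 2 + t * (a 0 - o 0) ∧
      c 0 = o 0 - (a 0 - o 0) / 2 + t * (a 1 - o 1) ∧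
      c 1 = o 1 - (a 1 - o 1) / 2 - t * (a 0 - o 0) ∧
      (x 0 = 2 * o 0 - a 0 ∧ x 1 = 2 * o 1 - a 1) ∧ (y 0 = 2 * o 0 - b 0 ∧ y 1 = 2 * o 1 - b 1) ∧
      (z 0 = 2 * o 0 - c 0 ∧ z 1 = 2 * o 1 - c 1) := by
  have sq : ∀ {p q r s : Plane}, dist p q = dist r s →
      (p 0 - q 0) ^ 2 + (p 1 - q 1) ^ 2 = (r 0 - s 0) ^ 2 + (r 1 - s 1) ^ 2 := by
    intro p q r s h
    rw [← plane_dist_sq, ← plane_dist_sq, h]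
  have hA : 0 < (a 0 - b 0) ^ 2 + (a 1 - b 1) ^ 2 := by
    rw [← plane_dist_sq]
    exact pow_pos (dist_pos.2 h.ne) 2
  obtain ⟨o, ho₀, ho₁⟩ : ∃ o : Plane, o 0 = (a 0 + b 0 + c 0) / 3 ∧ o 1 = (a 1 + b 1 + c 1) / 3 :=
    ⟨!₂[(a 0 + b 0 + c 0) / 3, (a 1 + b 1 + c 1) / 3], by simp, by simp⟩
  have hac := sq h.ac
  have hbc := sq h.bc
  obtain ⟨hR, t, ht, hv₀, hv₁⟩ := equilateral_coordinates (u₀ := a 0 - o 0) (u₁ := a 1 - o 1)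
    (v₀ := b 0 - o 0) (v₁ := b 1 - o 1) hA (by ring)
    (by rw [ho₀, ho₁, ← hac]; ring) (by rw [ho₀, ho₁, ← hbc]; ring)
  have hw₀ : c 0 - o 0 = -(a 0 - o 0) / 2 + t * (a 1 - o 1) := by
    linear_combination -hv₀ - 3 * ho₀
  have hw₁ : c 1 - o 1 = -(a 1 - o 1) / 2 - t * (a 0 - o 0) := by
    linear_combination -hv₁ - 3 * ho₁
  have hU : 0 < (a 0 - o 0) ^ 2 + (a 1 - o 1) ^ 2 := by linarith
  have ht0 : t ≠ 0 := by
    rintro rfl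
    norm_num at ht
  clear ho₀ ho₁ hac hbc hR
  obtain ⟨u₀, hu₀⟩ : ∃ u₀, a 0 = o 0 + u₀ := ⟨a 0 - o 0, by ring⟩
  obtain ⟨u₁, hu₁⟩ : ∃ u₁, a 1 = o 1 + u₁ := ⟨a 1 - o 1, by ring⟩
  obtain ⟨v₀, hv₀'⟩ : ∃ v₀, b 0 = o 0 + v₀ := ⟨b 0 - o 0, by ring⟩
  obtain ⟨v₁, hv₁'⟩ : ∃ v₁, b 1 = o 1 + v₁ := ⟨b 1 - o 1, by ring⟩
  obtain ⟨w₀, hw₀'⟩ : ∃ w₀, c 0 = o 0 + w₀ := ⟨c 0 - o 0, by ring⟩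
  obtain ⟨w₁, hw₁'⟩ : ∃ w₁, c 1 = o 1 + w₁ := ⟨c 1 - o 1, by ring⟩
  simp only [hu₀, hu₁, hv₀', hv₁', hw₀', hw₁', add_sub_cancel_left] at hv₀ hv₁ hw₀ hw₁ hU
  have hV : v₀ ^ 2 + v₁ ^ 2 = u₀ ^ 2 + u₁ ^ 2 := by
    rw [hv₀, hv₁]; linear_combination (u₀ ^ 2 + u₁ ^ 2) * ht
  have hW : w₀ ^ 2 + w₁ ^ 2 = u₀ ^ 2 + u₁ ^ 2 := by
    rw [hw₀, hw₁]; linear_combination (u₀ ^ 2 + u₁ ^ 2) * ht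
  obtain ⟨s, hx₀, hx₁⟩ := exists_eq_mul_of_equidistant (x₀ := x 0 - o 0) (x₁ := x 1 - o 1) ht0
    hU.ne' hv₀ hv₁ hw₀ hw₁ (by
      have := sq (h.bx.trans h.cx.symm)
      rw [hv₀', hv₁', hw₀', hw₁'] at this
      linear_combination this)
  obtain ⟨s', hy₀, hy₁⟩ := exists_eq_mul_of_equidistant (x₀ := y 0 - o 0) (x₁ := y 1 - o 1)
    (p₀ := w₀) (p₁ := w₁) (q₀ := u₀) (q₁ := u₁) ht0 (hV.trans_ne hU.ne')
    (by rw [hw₀, hv₀, hv₁]; linear_combination u₀ * ht)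
    (by rw [hw₁, hv₀, hv₁]; linear_combination u₁ * ht)
    (by rw [hv₀, hv₁]; linear_combination -u₀ * ht)
    (by rw [hv₀, hv₁]; linear_combination -u₁ * ht) (by
      have := sq h.cy
      rw [hu₀, hu₁, hw₀', hw₁'] at this
      linear_combination this)
  obtain ⟨s'', hz₀, hz₁⟩ := exists_eq_mul_of_equidistant (x₀ := z 0 - o 0) (x₁ := z 1 - o 1)
    (p₀ := u₀) (p₁ := u₁) (q₀ := v₀) (q₁ := v₁) ht0 (hW.trans_ne hU.ne')
    (by rw [hw₀, hw₁]; linear_combination -u₀ * ht)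
    (by rw [hw₀, hw₁]; linear_combination -u₁ * ht)
    (by rw [hv₀, hw₀, hw₁]; linear_combination u₀ * ht)
    (by rw [hv₁, hw₀, hw₁]; linear_combination u₁ * ht) (by
      have := sq (h.az.trans h.bz.symm)
      rw [hu₀, hu₁, hv₀', hv₁'] at this
      linear_combination this)
  have ex₀ : x 0 = o 0 + s * u₀ := by linarith
  have ex₁ : x 1 = o 1 + s * u₁ := by linarith
  have ey₀ : y 0 = o 0 + s' * v₀ := by linarith
  have ey₁ : y 1 = o 1 + s' * v₁ := by linarith
  have ez₀ : z 0 = o 0 + s'' * w₀ := by linarith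
  have ez₁ : z 1 = o 1 + s'' * w₁ := by linarith
  have hs' : s = s' := by
    have e₁ := sq h.bx
    have e₂ := sq h.bY
    rw [ex₀, ex₁, ey₀, ey₁, hu₀, hu₁, hv₀', hv₁', hv₀, hv₁] at e₁
    rw [ex₀, ex₁, ey₀, ey₁, hu₀, hu₁, hv₀', hv₁', hv₀, hv₁] at e₂
    have : (u₀ ^ 2 + u₁ ^ 2) * s = (u₀ ^ 2 + u₁ ^ 2) * s' := by
      linear_combination (e₁ + e₂ - (u₀ ^ 2 + u₁ ^ 2) * (2 - 2 * s') * ht) / 3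
    exact mul_left_cancel₀ hU.ne' this
  have hs'' : s = s'' := by
    have e₁ := sq (h.cx.trans h.az.symm)
    have e₂ := sq h.cZ
    rw [ex₀, ex₁, ez₀, ez₁, hu₀, hu₁, hw₀', hw₁', hw₀, hw₁] at e₁
    rw [ex₀, ex₁, ez₀, ez₁, hu₀, hu₁, hw₀', hw₁', hw₀, hw₁] at e₂
    have : (u₀ ^ 2 + u₁ ^ 2) * s = (u₀ ^ 2 + u₁ ^ 2) * s'' := by
      linear_combination (e₁ + e₂ - (u₀ ^ 2 + u₁ ^ 2) * (2 - 2 * s'') * ht) / 3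
    exact mul_left_cancel₀ hU.ne' this
  have hs : s = -1 := by
    have e := sq h.xy
    rw [hu₀, hu₁, hv₀', hv₁'] at hA
    rw [ex₀, ex₁, ey₀, ey₁, hu₀, hu₁, hv₀', hv₁', ← hs'] at e
    have : ((o 0 + u₀ - (o 0 + v₀)) ^ 2 + (o 1 + u₁ - (o 1 + v₁)) ^ 2) * ((s - 1) * (s + 1)) = 0 := by
      linear_combination e
    rcases mul_eq_zero.1 ((mul_eq_zero.1 this).resolve_left hA.ne') with h1 | h1
    · exfalso
      apply h.ne_x
      have : s = 1 := by linarith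
      exact plane_ext (by rw [ex₀, hu₀, this, one_mul]) (by rw [ex₁, hu₁, this, one_mul])
    · linarith
  rw [hs] at ex₀ ex₁
  rw [← hs', hs] at ey₀ ey₁
  rw [← hs'', hs] at ez₀ ez₁
  refine ⟨o, t, ht, ?_, ?_, ?_, ?_, ?_, ⟨?_, ?_⟩, ⟨?_, ?_⟩, ?_, ?_⟩
  · simpa only [hu₀, hu₁, add_sub_cancel_left] using hU
  · rw [hu₀, hu₁, hv₀', hv₀]; ring
  · rw [hu₀, hu₁, hv₁', hv₁]; ring
  · rw [hu₀, hu₁, hw₀', hw₀]; ring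
  · rw [hu₀, hu₁, hw₁', hw₁]; ring
  all_goals linarith

theorem exists_polar (x y : ℝ) (h : 0 < x ^ 2 + y ^ 2) :
    ∃ r θ : ℝ, 0 < r ∧ x = r * Real.cos θ ∧ y = r * Real.sin θ := by
  refine ⟨‖(⟨x, y⟩ : ℂ)‖, Complex.arg ⟨x, y⟩, ?_, ?_, ?_⟩
  · refine norm_pos_iff.2 fun h0 => ?_
    have h1 := congrArg Complex.re h0
    have h2 := congrArg Complex.im h0
    simp only [Complex.zero_re, Complex.zero_im] at h1 h2
    simp [h1, h2] at h
  · rw [Complex.norm_mul_cos_arg]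
  · rw [Complex.norm_mul_sin_arg]

theorem cos_two_pi_div_three' : Real.cos (2 * (Real.pi / 3)) = -(1 / 2) := by
  rw [Real.cos_two_mul, Real.cos_pi_div_three]
  norm_num

theorem sin_two_pi_div_three' : Real.sin (2 * (Real.pi / 3)) = √3 / 2 := by
  rw [Real.sin_two_mul, Real.cos_pi_div_three, Real.sin_pi_div_three]
  ring

theorem hexVertex_add_three (c : Plane) (r θ t : ℝ) :
    (hexVertex c r θ (t + 3) 0 = 2 * c 0 - hexVertex c r θ t 0) ∧
      hexVertex c r θ (t + 3) 1 = 2 * c 1 - hexVertex c r θ t 1 := by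
  have : θ + (t + 3) * (Real.pi / 3) = θ + t * (Real.pi / 3) + Real.pi := by ring
  simp only [hexVertex_apply_zero, hexVertex_apply_one, this, Real.cos_add_pi, Real.sin_add_pi]
  constructor <;> ring

theorem hexVertex_add_two (c : Plane) (r θ t : ℝ) :
    (hexVertex c r θ (t + 2) 0 = c 0 - (hexVertex c r θ t 0 - c 0) / 2 -
      √3 / 2 * (hexVertex c r θ t 1 - c 1)) ∧
    (hexVertex c r θ (t + 2) 1 = c 1 - (hexVertex c r θ t 1 - c 1) / 2 +
      √3 / 2 * (hexVertex c r θ t 0 - c 0)) := by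
  have : θ + (t + 2) * (Real.pi / 3) = θ + t * (Real.pi / 3) + 2 * (Real.pi / 3) := by ring
  simp only [hexVertex_apply_zero, hexVertex_apply_one, this, Real.cos_add _ (2 * _),
    Real.sin_add _ (2 * _), cos_two_pi_div_three', sin_two_pi_div_three']
  constructor <;> ring

theorem isRegularHexagon_iff {S : Set Plane} : IsRegularHexagon S ↔
    ∃ (c : Plane) (r θ : ℝ), 0 < r ∧ S = {hexVertex c r θ 0, hexVertex c r θ 1, hexVertex c r θ 2,
      hexVertex c r θ 3, hexVertex c r θ 4, hexVertex c r θ 5} := by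
  have key : ∀ (c : Plane) (r θ : ℝ), (Set.range fun k : Fin 6 =>
      c + r • !₂[Real.cos (θ + ((k : ℕ) : ℝ) * (Real.pi / 3)),
        Real.sin (θ + ((k : ℕ) : ℝ) * (Real.pi / 3))]) = {hexVertex c r θ 0, hexVertex c r θ 1,
          hexVertex c r θ 2, hexVertex c r θ 3, hexVertex c r θ 4, hexVertex c r θ 5} := by
    intro c r θ
    ext p
    simp only [Set.mem_range, Fin.exists_fin_succ, hexVertex, Set.mem_insert_iff,
      Set.mem_singleton_iff, eq_comm (b := p)]
    norm_num
  simp only [IsRegularHexagon, key]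

theorem HasHexagonDistances.isRegularHexagon {a b c x y z : Plane}
    (h : HasHexagonDistances a b c x y z) : IsRegularHexagon {a, b, c, x, y, z} := by
  obtain ⟨b, c, y, z, hset, o, t, ht, hU, hb₀, hb₁, hc₀, hc₁, ⟨hx₀, hx₁⟩, ⟨hy₀, hy₁⟩, hz₀, hz₁⟩ :
      ∃ b' c' y' z', ({a, b, c, x, y, z} : Set Plane) = {a, b', c', x, y', z'} ∧
      ∃ (o : Plane) (t : ℝ), t = √3 / 2 ∧ 0 < (a 0 - o 0) ^ 2 + (a 1 - o 1) ^ 2 ∧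
      b' 0 = o 0 - (a 0 - o 0) / 2 - t * (a 1 - o 1) ∧
      b' 1 = o 1 - (a 1 - o 1) / 2 + t * (a 0 - o 0) ∧
      c' 0 = o 0 - (a 0 - o 0) / 2 + t * (a 1 - o 1) ∧
      c' 1 = o 1 - (a 1 - o 1) / 2 - t * (a 0 - o 0) ∧
      (x 0 = 2 * o 0 - a 0 ∧ x 1 = 2 * o 1 - a 1) ∧
      (y' 0 = 2 * o 0 - b' 0 ∧ y' 1 = 2 * o 1 - b' 1) ∧
      (z' 0 = 2 * o 0 - c' 0 ∧ z' 1 = 2 * o 1 - c' 1) := by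
    obtain ⟨o, t, ht, hU, hb₀, hb₁, hc₀, hc₁, hx, hy, hz⟩ := h.coordinates
    have h3 : (√3 / 2) ^ 2 = (3 / 4 : ℝ) := by
      rw [div_pow, Real.sq_sqrt (by norm_num)]
      norm_num
    rcases sq_eq_sq_iff_eq_or_eq_neg.1 (ht.trans h3.symm) with rfl | rfl
    · exact ⟨b, c, y, z, rfl, o, _, rfl, hU, hb₀, hb₁, hc₀, hc₁, hx, hy, hz⟩
    · refine ⟨c, b, z, y, ?_, o, _, rfl, hU, by linarith, by linarith, by linarith, by linarith,
        hx, hz, hy⟩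
      rw [Set.insert_comm b c, Set.pair_comm y z]
  subst ht
  rw [hset, isRegularHexagon_iff]
  obtain ⟨r, θ, hr, hu₀, hu₁⟩ := exists_polar _ _ hU
  have h0 : a = hexVertex o r θ 0 := by
    apply plane_ext
    · rw [hexVertex_apply_zero, zero_mul, add_zero, ← hu₀]; ring
    · rw [hexVertex_apply_one, zero_mul, add_zero, ← hu₁]; ring
  have h2 : b = hexVertex o r θ 2 := by
    have := hexVertex_add_two o r θ 0
    rw [zero_add, ← h0] at this
    exact plane_ext (hb₀.trans this.1.symm) (hb₁.trans this.2.symm)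
  have h4 : c = hexVertex o r θ 4 := by
    have := hexVertex_add_two o r θ 2
    rw [show (2 : ℝ) + 2 = 4 by norm_num, ← h2, hb₀, hb₁] at this
    have h3 : √3 ^ 2 = (3 : ℝ) := Real.sq_sqrt (by norm_num)
    refine plane_ext ?_ ?_
    · rw [this.1, hc₀]
      linear_combination (a 0 - o 0) / 4 * h3
    · rw [this.2, hc₁]
      linear_combination (a 1 - o 1) / 4 * h3
  have h3 : x = hexVertex o r θ 3 := by
    have := hexVertex_add_three o r θ 0
    rw [zero_add, ← h0] at this
    exact plane_ext (hx₀.trans this.1.symm) (hx₁.trans this.2.symm)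
  have h5 : y = hexVertex o r θ 5 := by
    have := hexVertex_add_three o r θ 2
    rw [show (2 : ℝ) + 3 = 5 by norm_num, ← h2] at this
    exact plane_ext (hy₀.trans this.1.symm) (hy₁.trans this.2.symm)
  have h1 : z = hexVertex o r θ 1 := by
    have := hexVertex_add_three o r θ 1
    rw [show (1 : ℝ) + 3 = 4 by norm_num, ← h4] at this
    exact plane_ext (by linarith [this.1]) (by linarith [this.2])
  refine ⟨o, r, θ, hr, ?_⟩
  rw [h0, h1, h2, h3, h4, h5]
  ext p
  simp only [Set.mem_insert_iff, Set.mem_singleton_iff]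
  constructor <;> rintro (h | h | h | h | h | h) <;> simp only [h, true_or, or_true]

theorem dist_hexVertex (c : Plane) {r : ℝ} (hr : 0 < r) (θ t : ℝ) :
    dist c (hexVertex c r θ t) = r := by
  refine (sq_eq_sq₀ dist_nonneg hr.le).1 ?_
  rw [plane_dist_sq, hexVertex_apply_zero, hexVertex_apply_one]
  linear_combination r ^ 2 * Real.sin_sq_add_cos_sq (θ + t * (Real.pi / 3))

theorem hexVertex_add_six (c : Plane) (r θ t : ℝ) :
    hexVertex c r θ (t + 6) = hexVertex c r θ t := by
  have : θ + (t + 6) * (Real.pi / 3) = θ + t * (Real.pi / 3) + 2 * Real.pi := by ring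
  simp only [hexVertex, this, Real.cos_add_two_pi, Real.sin_add_two_pi]

theorem hexVertex_injective (c : Plane) {r : ℝ} (hr : 0 < r) (θ : ℝ) :
    Function.Injective fun k : Fin 6 => hexVertex c r θ (k : ℕ) := by
  intro i j h
  simp only at h
  have h₀ := congrArg (fun p : Plane => p 0) h
  have h₁ := congrArg (fun p : Plane => p 1) h
  simp only [hexVertex_apply_zero, hexVertex_apply_one, add_right_inj] at h₀ h₁
  have h := Real.Angle.cos_sin_inj (mul_left_cancel₀ hr.ne' h₀) (mul_left_cancel₀ hr.ne' h₁)
  obtain ⟨n, hn⟩ := Real.Angle.angle_eq_iff_two_pi_dvd_sub.1 h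
  have h6 : (((i : ℕ) : ℤ) - ((j : ℕ) : ℤ) : ℤ) = 6 * n := by
    have h : (((i : ℕ) : ℝ) - ((j : ℕ) : ℝ) - 6 * n) * (Real.pi / 3) = 0 := by linarith
    have h := (mul_eq_zero.1 h).resolve_right (by positivity)
    have h : (((i : ℕ) : ℝ) - ((j : ℕ) : ℝ)) = 6 * n := by linarith
    exact_mod_cast h
  have hi := i.2
  have hj := j.2
  apply Fin.ext
  omega

/-- The reflection that maps the vertex `t` of a hexagon to the vertex `m - t`. -/
noncomputable def hexReflection (c : Plane) (θ m : ℝ) (p : Plane) : Plane :=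
  !₂[c 0 + Real.cos (2 * θ + m * (Real.pi / 3)) * (p 0 - c 0) +
      Real.sin (2 * θ + m * (Real.pi / 3)) * (p 1 - c 1),
    c 1 + Real.sin (2 * θ + m * (Real.pi / 3)) * (p 0 - c 0) -
      Real.cos (2 * θ + m * (Real.pi / 3)) * (p 1 - c 1)]

theorem isometry_hexReflection (c : Plane) (θ m : ℝ) : Isometry (hexReflection c θ m) := by
  refine Isometry.of_dist_eq fun p q => (sq_eq_sq₀ dist_nonneg dist_nonneg).1 ?_
  simp only [plane_dist_sq, hexReflection, Matrix.cons_val_zero,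
    Matrix.cons_val_one]
  linear_combination ((p 0 - q 0) ^ 2 + (p 1 - q 1) ^ 2) *
    Real.sin_sq_add_cos_sq (2 * θ + m * (Real.pi / 3))

theorem hexReflection_hexReflection (c : Plane) (θ m : ℝ) (p : Plane) :
    hexReflection c θ m (hexReflection c θ m p) = p := by
  have h := Real.sin_sq_add_cos_sq (2 * θ + m * (Real.pi / 3))
  apply plane_ext
  · simp only [hexReflection, Matrix.cons_val_zero, Matrix.cons_val_one]
    linear_combination (p 0 - c 0) * h
  · simp only [hexReflection, Matrix.cons_val_zero, Matrix.cons_val_one]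
    linear_combination (p 1 - c 1) * h

theorem hexReflection_hexVertex (c : Plane) (r θ m t : ℝ) :
    hexReflection c θ m (hexVertex c r θ t) = hexVertex c r θ (m - t) := by
  have h : θ + (m - t) * (Real.pi / 3) =
      2 * θ + m * (Real.pi / 3) - (θ + t * (Real.pi / 3)) := by ring
  apply plane_ext
  · simp only [hexReflection, Matrix.cons_val_zero, hexVertex_apply_zero,
      hexVertex_apply_one, h, Real.cos_sub]
    ring
  · simp only [hexReflection, Matrix.cons_val_one, Matrix.cons_val_zero, hexVertex_apply_zero,
      hexVertex_apply_one, h, Real.sin_sub]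
    ring

theorem hexVertex_fin_sub (c : Plane) (r θ : ℝ) (m k : Fin 6) :
    hexVertex c r θ ((m - k : Fin 6) : ℕ) = hexVertex c r θ ((m : ℕ) - (k : ℕ)) := by
  rcases le_or_gt k m with h | h
  · rw [Fin.coe_sub_iff_le.2 h, Nat.cast_sub h]
  · rw [Fin.coe_sub_iff_lt.2 h, Nat.cast_sub (by omega), ← hexVertex_add_six _ _ _ ((m : ℕ) - (k : ℕ) : ℝ)]
    congr 1
    push_cast
    ring

/-- Up to reflections, there are three triples of vertices of a hexagon. -/
theorem exists_image_sub_mem : ∀ t ∈ Finset.powersetCard 3 (Finset.univ : Finset (Fin 6)),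
    ∃ m n : Fin 6,
      t.image (fun k => m - k) ∈
        ({{0, 1, 2}, {0, 1, 3}, {0, 2, 4}} : Finset (Finset (Fin 6))) ∨
      (t.image fun k => m - k).image (fun k => n - k) ∈
        ({{0, 1, 2}, {0, 1, 3}, {0, 2, 4}} : Finset (Finset (Fin 6))) := by
  decide +kernel

theorem IsRegularHexagon.encard_eq {S : Set Plane} (hS : IsRegularHexagon S) : S.encard = 6 := by
  obtain ⟨c, r, θ, hr, rfl⟩ := hS
  change (Set.range fun k : Fin 6 => hexVertex c r θ (k : ℕ)).encard = 6
  rw [← Set.image_univ, (hexVertex_injective c hr θ).encard_image, Set.encard_univ]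
  simp

theorem IsRegularHexagon.encard_distinctTriangles_le {S : Set Plane} (hS : IsRegularHexagon S) :
    (distinctTriangles S).encard ≤ 3 := by
  obtain ⟨c, r, θ, hr, hS⟩ := hS
  have hinj := hexVertex_injective c hr θ
  set h : Fin 6 → Plane := fun k => hexVertex c r θ (k : ℕ) with hh
  have hrange : S = Set.range h := hS
  have hrefl : ∀ (m : Fin 6) (t : Finset (Fin 6)), ∃ e : Plane ≃ᵢ Plane,
      e '' (h '' t) = h '' (t.image fun k => m - k : Finset (Fin 6)) := by
    intro m t
    refine ⟨IsometryEquiv.mk' _ _ (hexReflection_hexReflection c θ (m : ℕ))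
      (isometry_hexReflection c θ (m : ℕ)), ?_⟩
    rw [Finset.coe_image, Set.image_image, Set.image_image]
    refine Set.image_congr fun k _ => ?_
    exact (hexReflection_hexVertex c r θ (m : ℕ) (k : ℕ)).trans (hexVertex_fin_sub c r θ m k).symm
  have hcard : ∀ t : Finset (Fin 6), t.card = 3 → (h '' t).encard = 3 := by
    intro t ht
    rw [hinj.encard_image, Set.encard_coe_eq_coe_finsetCard, ht]
    rfl
  have hsub : distinctTriangles S ⊆
      {Quotient.mk triangleSetoid ⟨h '' ({0, 1, 2} : Finset (Fin 6)), hcard _ rfl⟩,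
        Quotient.mk triangleSetoid ⟨h '' ({0, 1, 3} : Finset (Fin 6)), hcard _ rfl⟩,
        Quotient.mk triangleSetoid ⟨h '' ({0, 2, 4} : Finset (Fin 6)), hcard _ rfl⟩} := by
    rintro _ ⟨⟨T, hT⟩, hTS, rfl⟩
    simp only [Set.mem_ofPred_eq] at hTS
    obtain ⟨t, rfl⟩ : ∃ t : Finset (Fin 6), h '' t = T := by
      refine ⟨(Set.toFinite (h ⁻¹' T)).toFinset, ?_⟩
      rw [Set.Finite.coe_toFinset, Set.image_preimage_eq_of_subset]
      rwa [← hrange]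
    have ht : t.card = 3 := by
      rw [hinj.encard_image, Set.encard_coe_eq_coe_finsetCard] at hT
      exact_mod_cast hT
    obtain ⟨u, hu, e, he⟩ : ∃ u ∈ ({{0, 1, 2}, {0, 1, 3}, {0, 2, 4}} : Finset (Finset (Fin 6))),
        ∃ e : Plane ≃ᵢ Plane, e '' (h '' t) = h '' u := by
      obtain ⟨m, n, hmn | hmn⟩ := exists_image_sub_mem t (Finset.mem_powersetCard_univ.2 ht)
      · exact ⟨_, hmn, hrefl m t⟩
      · obtain ⟨e, he⟩ := hrefl m t
        obtain ⟨f, hf⟩ := hrefl n (t.image fun k => m - k)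
        refine ⟨_, hmn, e.trans f, ?_⟩
        rw [← hf, ← he, Set.image_image f e]
        rfl
    simp only [Finset.mem_insert, Finset.mem_singleton] at hu
    rcases hu with rfl | rfl | rfl
    · exact Or.inl (Quotient.sound ⟨e, he⟩)
    · exact Or.inr (Or.inl (Quotient.sound ⟨e, he⟩))
    · exact Or.inr (Or.inr (Quotient.sound ⟨e, he⟩))
  calc (distinctTriangles S).encard ≤ _ := Set.encard_le_encard hsub
    _ ≤ _ := Set.encard_insert_le _ _
    _ ≤ 2 + 1 := by gcongr; exact (Set.encard_insert_le _ _).trans (by rw [Set.encard_singleton]; rfl)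
    _ = 3 := rfl

theorem distinctTriangles_mono {S T : Set Plane} (h : S ⊆ T) :
    distinctTriangles S ⊆ distinctTriangles T :=
  Set.image_mono fun _ hU => Set.Subset.trans hU h

theorem isRegularHexagon_of_encard_eq {S : Set Plane} (hS : S.encard = 6)
    (hT : (distinctTriangles S).encard ≤ 3) : IsRegularHexagon S := by
  obtain ⟨a, b, c, x, y, z, rfl, h⟩ := exists_hexagonDistances hS hT
  exact h.isRegularHexagon

/-- A regular hexagon lies on a circle and is symmetric with respect to its centre. -/
theorem IsRegularHexagon.exists_center {S : Set Plane} (hS : IsRegularHexagon S) :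
    ∃ (c : Plane) (r : ℝ), 0 < r ∧ (∀ p ∈ S, dist c p = r) ∧
      ∀ p ∈ S, ∃ q ∈ S, q 0 = 2 * c 0 - p 0 ∧ q 1 = 2 * c 1 - p 1 := by
  obtain ⟨c, r, θ, hr, hS⟩ := hS
  have hS : S = Set.range fun k : Fin 6 => hexVertex c r θ (k : ℕ) := hS
  refine ⟨c, r, hr, ?_, ?_⟩
  · rw [hS]
    rintro _ ⟨k, rfl⟩
    exact dist_hexVertex c hr θ _
  · rw [hS]
    rintro _ ⟨k, rfl⟩
    refine ⟨_, ⟨k - 3, rfl⟩, ?_⟩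
    have h := hexVertex_add_three c r θ ((k : ℕ) - ((3 : Fin 6) : ℕ))
    rw [show ((k : ℕ) - ((3 : Fin 6) : ℕ) + 3 : ℝ) = (k : ℕ) by simp, ← hexVertex_fin_sub] at h
    exact ⟨by linarith [h.1], by linarith [h.2]⟩

theorem encard_le_six {S : Set Plane} (hS : (distinctTriangles S).encard ≤ 3) : S.encard ≤ 6 := by
  by_contra! hlt
  obtain ⟨U, hUS, hU⟩ := Set.exists_subset_encard_eq (s := S) (k := 7) (Order.add_one_le_of_lt hlt)
  have hex : ∀ x ∈ U, IsRegularHexagon (U \ {x}) := by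
    intro x hx
    refine isRegularHexagon_of_encard_eq ?_ ((Set.encard_le_encard
      (distinctTriangles_mono (Set.sdiff_subset.trans hUS))).trans hS)
    rw [Set.encard_sdiff_singleton_of_mem hx, hU]
    rfl
  obtain ⟨x, y, hx, hy, hxy⟩ := Set.one_lt_encard_iff.1 (show 1 < U.encard by rw [hU]; decide)
  obtain ⟨c, r, hr, hdist, hsymm⟩ := (hex x hx).exists_center
  obtain ⟨c', r', hr', hdist', hsymm'⟩ := (hex y hy).exists_center
  have hcc : c = c' := by
    by_contra hne
    have hcard : ((U \ {x}) \ {y}).encard = 5 := by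
      rw [Set.encard_sdiff_singleton_of_mem (show y ∈ U \ {x} from ⟨hy, hxy.symm⟩),
        Set.encard_sdiff_singleton_of_mem hx, hU]
      rfl
    obtain ⟨V, hV, hV3⟩ := Set.exists_subset_encard_eq (s := (U \ {x}) \ {y}) (k := 3)
      (by rw [hcard]; decide)
    obtain ⟨p, q, s, hpq, hps, hqs, rfl⟩ := Set.encard_eq_three.1 hV3
    have h₁ : ∀ v ∈ ({p, q, s} : Set Plane), dist c v = r := fun v hv => hdist v (hV hv).1
    have h₂ : ∀ v ∈ ({p, q, s} : Set Plane), dist c' v = r' := fun v hv =>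
      hdist' v ⟨(hV hv).1.1, (hV hv).2⟩
    exact not_dist_eq_three hne hpq hps hqs (by rw [h₁ p (by simp), h₁ q (by simp)])
      (by rw [h₁ q (by simp), h₁ s (by simp)]) (by rw [h₂ p (by simp), h₂ q (by simp)])
      (by rw [h₂ q (by simp), h₂ s (by simp)])
  subst hcc
  obtain ⟨q, hq, hq₀, hq₁⟩ := hsymm y ⟨hy, hxy.symm⟩
  have hqy : q ≠ y := by
    rintro rfl
    have h := hdist q hq
    rw [show c = q from plane_ext (by linarith) (by linarith), dist_self] at h
    exact hr.ne h
  obtain ⟨p, hp, hp₀, hp₁⟩ := hsymm' q ⟨hq.1, hqy⟩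
  exact hp.2 (plane_ext (by linarith) (by linarith))

theorem theorem1p1 :
    (∀ S : Set Plane, (distinctTriangles S).encard ≤ 3 → S.encard ≤ 6) ∧
    (∀ S : Set Plane,
      (S.encard = 6 ∧ (distinctTriangles S).encard ≤ 3) ↔ IsRegularHexagon S) :=
  ⟨fun _ hS => encard_le_six hS, fun _ => ⟨fun h => isRegularHexagon_of_encard_eq h.1 h.2,
    fun h => ⟨h.encard_eq, h.encard_distinctTriangles_le⟩⟩⟩
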